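/- **Theorem (Lower bound on minimax MSE).** Let $D\ge 1$, let $\mathcal X\subset\mathbb R^D$ be compact with a Borel base measure $\mu$ (e.g. Lebesgue measure), $\mu(\mathcal X)=1$, and let $\{\psi_z\}_{z\in\mathbb Z^D}$ be an orthonormal basis of the complex space $L^2(\mathcal X,\mu)$ with $\psi_0=1$ and $\sup_z\|\psi_z\|_\infty<\infty$, such that for every $\zeta\ge 0$ the family $\{\psi_z:\|z\|_\infty=\zeta\}$ is closed under complex conjugation (as for every real basis and for the Fourier basis, where $\overline{\psi_z}=\psi_{-z}$). Let $\mathcal Z\subseteq\mathbb Z^D$ be a set of indices containing some $z\neq 0$, and let $a=\{a_z\}_{z\in\mathcal Z}$ and $b=\{b_z\}_{z\in\mathcal Z}$ be $(0,\infty)$-valued, with $b_0>1$ if $0\in\mathcal Z$. For real $h\in L^2(\mathcal X,\mu)$ put $$\tilde h_z=\int_{\mathcal X} h\,\overline{\psi_z}\,d\mu,\qquad \|h\|_a^2=\sum_{z\in\mathcal Z}\frac{|\tilde h_z|^2}{a_z^2},\qquad \|h\|_b^2=\sum_{z\in\mathcal Z}\frac{|\tilde h_z|^2}{b_z^2},$$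 and for $\zeta\ge 0$ $$A_\zeta=\sum_{z\in\mathcal Z,\ \|z\|_\infty\le\zeta}a_z^{-2},\qquad B_\zeta=\sum_{z\in\mathcal Z,\ \|z\|_\infty\le\zeta}b_z^{-2}.$$ Let $$R_n=\inf_{\hat S}\ \sup_{h}\ \mathbb E_{X_1,\dots,X_n\overset{iid}{\sim}h}\Big[\big|\hat S(X_1,\dots,X_n)-\|h\|_a^2\big|^2\Big],$$ where the infimum is over all measurable complex-valued estimators and the supremum over all probability densities $h\in L^2(\mathcal X,\mu)$ with $\|h\|_b\le 1$ and $\|h\|_a<\infty$. All asymptotic relations for sequences are as $n\to\infty$, with constants that may depend on everything but $n$. 1. If $\zeta_n\ge 1$ are real numbers with $B_{\zeta_n}^2\asymp\zeta_n^D n^2$ and $B_{\zeta_n}\in\Omega(\zeta_n^{2D})$, then $$R_n\in\Omega\left(\max\left\{\frac{A_{\zeta_n}^2}{B_{\zeta_n}^2},\ \frac1n\right\}\right).$$ 2. If $B_\zeta\in o(\zeta^{2D})$ as $\zeta\to\infty$, then $$R_n\in\Omega\left(\max\left\{\frac{A_{n^{2/(3D)}}^2}{n^{8/3}},\ \frac1n\right\}\right).$$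 -/

import Mathlib

open MeasureTheory Filter Asymptotics Topology
open scoped ENNReal

noncomputable section

namespace QuadraticFourier

/-- The ambient Euclidean space `ℝ^D`. -/
abbrev Space (D : ℕ) : Type := EuclideanSpace ℝ (Fin D)

/-- Frequencies: `D`-tuples of integers. The norm `‖z‖` of a frequency is its sup norm. -/
abbrev Freq (D : ℕ) : Type := Fin D → ℤ

/-- The box `Z_ζ = {z ∈ ℤ^D : ‖z‖_∞ ≤ ζ}` (see `mem_box`). -/
def box (D : ℕ) (ζ : ℝ) : Finset (Freq D) :=
  Finset.Icc (fun _ => -⌊ζ⌋) (fun _ => ⌊ζ⌋)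

theorem mem_box {D : ℕ} {ζ : ℝ} (hζ : 0 ≤ ζ) (z : Freq D) : z ∈ box D ζ ↔ ‖z‖ ≤ ζ := by
  rw [box, Finset.mem_Icc, pi_norm_le_iff_of_nonneg hζ, Pi.le_def, Pi.le_def, ← forall_and]
  refine forall_congr' fun i => ?_
  rw [Int.norm_eq_abs, ← Int.cast_abs, ← Int.le_floor, abs_le]

/-- For a set `I` of indices of interest and weights `w`, the partial sum
`∑_{z ∈ I, ‖z‖_∞ ≤ ζ} w_z^{-2}`. -/
def weightSum {D : ℕ} (I : Set (Freq D)) (w : Freq D → ℝ) (ζ : ℝ) : ℝ :=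
  ∑ z ∈ box D ζ, I.indicator (fun z => (w z ^ 2)⁻¹) z

/-- The Fourier coefficient `∫ h conj(ψ_z) dν` of a real function `h`, with respect to a
Hilbert basis `ψ` of the complex space `L²(ν)`. -/
def coeff {D : ℕ} {ν : Measure (Space D)} (ψ : HilbertBasis (Freq D) ℂ (Lp ℂ 2 ν))
    (h : Space D → ℝ) (z : Freq D) : ℂ :=
  ∫ x, (h x : ℂ) * (starRingEnd ℂ) (ψ z x) ∂ν

/-- The squared seminorm `‖h‖_w² = ∑_{z ∈ I} |coeff_z h|² / w_z²`, possibly infinite. -/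
def seminormSq {D : ℕ} {ν : Measure (Space D)} (ψ : HilbertBasis (Freq D) ℂ (Lp ℂ 2 ν))
    (I : Set (Freq D)) (w : Freq D → ℝ) (h : Space D → ℝ) : ℝ≥0∞ :=
  ∑' z : I, ENNReal.ofReal (‖coeff ψ h z‖ ^ 2 / w z ^ 2)

/-- The square-integrable probability densities `h` with respect to `ν` in the unit ball
`‖h‖_b ≤ 1` for which the estimand `‖h‖_a²` is finite. -/
def densityBall {D : ℕ} {ν : Measure (Space D)} (ψ : HilbertBasis (Freq D) ℂ (Lp ℂ 2 ν))
    (I : Set (Freq D)) (a b : Freq D → ℝ) : Set (Space D → ℝ) :=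
  {h | MemLp h 2 ν ∧ 0 ≤ᵐ[ν] h ∧ ∫ x, h x ∂ν = 1 ∧
    seminormSq ψ I b h ≤ 1 ∧ seminormSq ψ I a h < ⊤}

/-- The joint law of `n` i.i.d. samples from the distribution with density `h`. -/
def sampleLaw {D : ℕ} (ν : Measure (Space D)) (h : Space D → ℝ) (n : ℕ) :
    Measure (Fin n → Space D) :=
  Measure.pi fun _ => ν.withDensity fun x => ENNReal.ofReal (h x)

/-- The mean squared error of the estimator `S` of `‖h‖_a²`. -/
def mse {D : ℕ} {ν : Measure (Space D)} (ψ : HilbertBasis (Freq D) ℂ (Lp ℂ 2 ν))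
    (I : Set (Freq D)) (a : Freq D → ℝ) (n : ℕ) (S : (Fin n → Space D) → ℂ)
    (h : Space D → ℝ) : ℝ≥0∞ :=
  ∫⁻ x, ENNReal.ofReal (‖S x - ((seminormSq ψ I a h).toReal : ℂ)‖ ^ 2) ∂(sampleLaw ν h n)

/-- The minimax mean squared error of estimating `‖h‖_a²` from `n` i.i.d. samples, over
densities with `‖h‖_b ≤ 1`; the infimum is over all (measurable, complex) estimators. -/
def minimaxRisk {D : ℕ} {ν : Measure (Space D)} (ψ : HilbertBasis (Freq D) ℂ (Lp ℂ 2 ν))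
    (I : Set (Freq D)) (a b : Freq D → ℝ) (n : ℕ) : ℝ≥0∞ :=
  ⨅ (S : (Fin n → Space D) → ℂ) (_ : Measurable S), ⨆ h ∈ densityBall ψ I a b, mse ψ I a n S h

/-- `r ∈ Ω(f)` for a `[0, ∞]`-valued sequence `r` and a nonnegative real sequence `f`. -/
def IsOmega (r : ℕ → ℝ≥0∞) (f : ℕ → ℝ) : Prop :=
  ∃ c : ℝ, 0 < c ∧ ∀ᶠ n in atTop, ENNReal.ofReal (c * f n) ≤ r n

end QuadraticFourier

end

/-! The method is Le Cam's: if two sampling laws are close in chi-square divergence, no estimator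
can tell apart the values of `‖·‖_a²` they carry, so the risk is at least a constant times the
squared gap (`le_cam_chiSq`). In `minimaxRisk_ge_of_mixture` one of the two laws is a uniform
mixture of i.i.d. laws whose densities share the same value of the estimand.

For the first term of the maximum, the uniform density is compared with the densities `1 + t ∑ ε_z
cas_z`, where `ε` are random signs and `z` runs over the nonzero frequencies `K` of a box. The
functions `cas_z = Re ψ_z + Im ψ_z` are real and orthonormal, and the squared modulus of the
coefficient at each `z ∈ K` is `t²` whatever the signs, so every choice of signs moves the estimand
by the same amount `t² ∑_K a_z⁻²`. Averaging over signs cancels the first-order part of the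
chi-square integral and leaves at most `exp (|K| n² t⁴ / 2)`.

With `t² = k / V` for a small constant `k`, three constraints appear: positivity of the densities
(`ζ^(2D) ≲ V`), membership in the ball (`B_ζ ≤ V`) and indistinguishability (`ζ^D n² ≲ V²`). The
resulting gap is of order `A_ζ / V`, up to the zero frequency. Claim 1 takes `V = B_ζ`; claim 2
takes `V = n^(4/3)`, `ζ = n^(2/(3D))`, which balances the first and third constraints.

The term `1 / n` comes from two densities with all coefficients on `K` equal to `t` and to `t + t /
√n`. Away from the uniform density the quadratic functional has a nonzero derivative, so the gap is
of order `1 / √n` while the chi-square integral over `n` samples stays bounded. -/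

noncomputable section

namespace QuadraticFourier

/-! ### Le Cam's inequality. -/

section LeCam

variable {Ω : Type*} [MeasurableSpace Ω]

/-- Le Cam's two-point inequality with the chi-square divergence: two densities `p₀`, `p₁` with
`∫ p₁² / p₀ ≤ C` cannot both allow to estimate well-separated parameters. -/
theorem le_cam_chiSq (Q : Measure Ω) (p₀ p₁ : Ω → ℝ) (hp₀ : Measurable p₀) (hp₁ : Measurable p₁)
    (hp₀_pos : ∀ x, 0 < p₀ x) (hp₁_nonneg : ∀ x, 0 ≤ p₁ x)
    (hp₁_one : ∫⁻ x, ENNReal.ofReal (p₁ x) ∂Q = 1) {C : ℝ} (hC : 0 ≤ C)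
    (hchi : ∫⁻ x, ENNReal.ofReal (p₁ x ^ 2 / p₀ x) ∂Q ≤ ENNReal.ofReal C)
    (S : Ω → ℂ) (hS : Measurable S) (t₀ t₁ : ℝ) (R : ℝ≥0∞)
    (h₀ : ∫⁻ x, ENNReal.ofReal (‖S x - t₀‖ ^ 2) * ENNReal.ofReal (p₀ x) ∂Q ≤ R)
    (h₁ : ∫⁻ x, ENNReal.ofReal (‖S x - t₁‖ ^ 2) * ENNReal.ofReal (p₁ x) ∂Q ≤ R) :
    ENNReal.ofReal ((t₁ - t₀) ^ 2 / (2 * (1 + C))) ≤ R := by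
  rcases eq_or_ne R ⊤ with rfl | hR
  · exact le_top
  lift R to NNReal using hR
  rcases eq_or_ne t₁ t₀ with rfl | hne
  · simp
  set δ : ℝ := |t₁ - t₀| with hδ
  have hδ_pos : 0 < δ := abs_pos.2 (sub_ne_zero.2 hne)
  -- Integrating `key` gives `δ ≤ 2 l R + (1 + C) / (4 l)`; this `l` makes the last term `δ / 2`,
  -- which is absorbed on the left.
  set l : ℝ := (1 + C) / (2 * δ) with hl
  have hl_pos : 0 < l := by positivity
  have key : ∀ x, δ * p₁ x ≤ l * (‖S x - t₁‖ ^ 2 * p₁ x) + 1 / (4 * l) * p₁ x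
      + l * (‖S x - t₀‖ ^ 2 * p₀ x) + 1 / (4 * l) * (p₁ x ^ 2 / p₀ x) := by
    intro x
    have htri : δ ≤ ‖S x - t₁‖ + ‖S x - t₀‖ := by
      have : ((t₁ - t₀ : ℝ) : ℂ) = -(S x - t₁) + (S x - t₀) := by push_cast; ring
      calc δ = ‖((t₁ - t₀ : ℝ) : ℂ)‖ := by rw [Complex.norm_real, Real.norm_eq_abs]
        _ ≤ _ := by rw [this]; exact (norm_add_le _ _).trans (by rw [norm_neg])
    have e1 : ∀ y : ℝ, y ≤ l * y ^ 2 + 1 / (4 * l) := by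
      intro y
      have : l * y ^ 2 + 1 / (4 * l) - y = l * (y - 1 / (2 * l)) ^ 2 := by field_simp; ring
      have : 0 ≤ l * (y - 1 / (2 * l)) ^ 2 := by positivity
      linarith
    -- Change of measure from `p₁` to `p₀`: AM-GM applied to the factors `‖S x - t₀‖ √p₀` and `p₁ /
    -- √p₀`.
    have e2 : ‖S x - t₀‖ * p₁ x
        ≤ l * (‖S x - t₀‖ ^ 2 * p₀ x) + 1 / (4 * l) * (p₁ x ^ 2 / p₀ x) := by
      have hp := hp₀_pos x
      have : l * (‖S x - t₀‖ ^ 2 * p₀ x) + 1 / (4 * l) * (p₁ x ^ 2 / p₀ x)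
          - ‖S x - t₀‖ * p₁ x = l * p₀ x * (‖S x - t₀‖ - p₁ x / (2 * l * p₀ x)) ^ 2 := by
        field_simp; ring
      have : 0 ≤ l * p₀ x * (‖S x - t₀‖ - p₁ x / (2 * l * p₀ x)) ^ 2 := by positivity
      linarith
    have e3 := mul_le_mul_of_nonneg_right (e1 ‖S x - t₁‖) (hp₁_nonneg x)
    have e4 := mul_le_mul_of_nonneg_right htri (hp₁_nonneg x)
    nlinarith
  have hint : ENNReal.ofReal δ ≤ ENNReal.ofReal (l * R + 1 / (4 * l) + l * R + 1 / (4 * l) * C) := by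
    have m : ∀ t : ℝ, Measurable fun x => ENNReal.ofReal (‖S x - t‖ ^ 2) := fun t => by fun_prop
    calc ENNReal.ofReal δ = ∫⁻ x, ENNReal.ofReal δ * ENNReal.ofReal (p₁ x) ∂Q := by
          rw [lintegral_const_mul _ (by fun_prop), hp₁_one, mul_one]
      _ ≤ ∫⁻ x, (ENNReal.ofReal l * (ENNReal.ofReal (‖S x - t₁‖ ^ 2) * ENNReal.ofReal (p₁ x))
            + ENNReal.ofReal (1 / (4 * l)) * ENNReal.ofReal (p₁ x)
            + ENNReal.ofReal l * (ENNReal.ofReal (‖S x - t₀‖ ^ 2) * ENNReal.ofReal (p₀ x))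
            + ENNReal.ofReal (1 / (4 * l)) * ENNReal.ofReal (p₁ x ^ 2 / p₀ x)) ∂Q := by
          refine lintegral_mono fun x => ?_
          have a1 := hp₁_nonneg x
          have a0 := (hp₀_pos x).le
          simp only [← ENNReal.ofReal_mul (sq_nonneg _), ← ENNReal.ofReal_mul hl_pos.le,
            ← ENNReal.ofReal_mul hδ_pos.le,
            ← ENNReal.ofReal_mul (show 0 ≤ 1 / (4 * l) by positivity)]
          rw [← ENNReal.ofReal_add (by positivity) (by positivity),
            ← ENNReal.ofReal_add (by positivity) (by positivity),
            ← ENNReal.ofReal_add (by positivity) (by positivity)]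
          exact ENNReal.ofReal_le_ofReal (key x)
      _ ≤ ENNReal.ofReal l * R + ENNReal.ofReal (1 / (4 * l)) * 1 + ENNReal.ofReal l * R
            + ENNReal.ofReal (1 / (4 * l)) * ENNReal.ofReal C := by
          rw [lintegral_add_left (by fun_prop), lintegral_add_left (by fun_prop),
            lintegral_add_left (by fun_prop), lintegral_const_mul _ (by fun_prop),
            lintegral_const_mul _ (by fun_prop), lintegral_const_mul _ (by fun_prop),
            lintegral_const_mul _ (by fun_prop), hp₁_one]
          gcongr
      _ = _ := by
          rw [← ENNReal.ofReal_coe_nnreal (p := R), ← ENNReal.ofReal_one,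
            ← ENNReal.ofReal_mul hl_pos.le, ← ENNReal.ofReal_mul (by positivity),
            ← ENNReal.ofReal_mul (by positivity), ← ENNReal.ofReal_add (by positivity) (by positivity),
            ← ENNReal.ofReal_add (by positivity) (by positivity),
            ← ENNReal.ofReal_add (by positivity) (by positivity), mul_one]
  rw [ENNReal.ofReal_le_ofReal_iff (by positivity)] at hint
  rw [← ENNReal.ofReal_coe_nnreal (p := R)]
  refine ENNReal.ofReal_le_ofReal ?_
  have h3 : l * R + 1 / (4 * l) + l * R + 1 / (4 * l) * C = (1 + C) / δ * R + δ / 2 := by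
    rw [hl]; field_simp; ring
  rw [h3] at hint
  have h4 : δ / 2 ≤ (1 + C) / δ * R := by linarith
  rw [← sq_abs, ← hδ, div_le_iff₀ (by positivity)]
  have := mul_le_mul_of_nonneg_left h4 hδ_pos.le
  have h5 : δ * ((1 + C) / δ * R) = (1 + C) * R := by field_simp
  nlinarith

end LeCam

/-! ### Product densities. -/

section Product

variable {Ω : Type*} [MeasurableSpace Ω]

theorem lintegral_pi_ofReal_prod (ν : Measure Ω) [IsProbabilityMeasure ν] (f : Ω → ℝ)
    (hf : Integrable f ν) (hf0 : 0 ≤ f) (n : ℕ) :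
    ∫⁻ x : Fin n → Ω, ENNReal.ofReal (∏ i, f (x i)) ∂(Measure.pi fun _ => ν)
      = ENNReal.ofReal ((∫ x, f x ∂ν) ^ n) := by
  rw [← ofReal_integral_eq_lintegral_ofReal (Integrable.fintype_prod fun _ => hf)
    (ae_of_all _ fun x => Finset.prod_nonneg fun i _ => hf0 (x i))]
  rw [integral_fintype_prod_eq_pow (ι := Fin n) f, Fintype.card_fin]

theorem pi_withDensity_ofReal (ν : Measure Ω) [IsProbabilityMeasure ν] (f : Ω → ℝ)
    (hf : Integrable f ν) (hf0 : 0 ≤ f) (n : ℕ) :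
    Measure.pi (fun _ : Fin n => ν.withDensity fun x => ENNReal.ofReal (f x))
      = (Measure.pi fun _ : Fin n => ν).withDensity
        fun x => ENNReal.ofReal (∏ i, f (x i)) := by
  have : IsFiniteMeasure (ν.withDensity fun x => ENNReal.ofReal (f x)) :=
    isFiniteMeasure_withDensity_ofReal hf.2
  refine Measure.pi_eq fun s hs => ?_
  rw [withDensity_apply _ (MeasurableSet.univ_pi hs), ← lintegral_indicator (MeasurableSet.univ_pi hs)]
  have e : ∀ x : Fin n → Ω, (Set.univ.pi s).indicator
      (fun x => ENNReal.ofReal (∏ i, f (x i))) x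
        = ENNReal.ofReal (∏ i, (s i).indicator f (x i)) := by
    intro x
    by_cases hx : x ∈ Set.univ.pi s
    · rw [Set.indicator_of_mem hx]
      congr 1
      exact Finset.prod_congr rfl fun i _ => (Set.indicator_of_mem (hx i trivial) _).symm
    · rw [Set.indicator_of_notMem hx]
      obtain ⟨i, hi⟩ : ∃ i, x i ∉ s i := by simpa [Set.mem_pi] using hx
      rw [Finset.prod_eq_zero (Finset.mem_univ i) (Set.indicator_of_notMem hi _), ENNReal.ofReal_zero]
  simp_rw [e]
  have hi : ∀ i, Integrable ((s i).indicator f) ν := fun i => hf.indicator (hs i)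
  rw [← ofReal_integral_eq_lintegral_ofReal (Integrable.fintype_prod_dep hi)
    (ae_of_all _ fun x => Finset.prod_nonneg fun i _ => Set.indicator_nonneg (fun y _ => hf0 y) _)]
  rw [integral_fintype_prod_eq_prod (𝕜 := ℝ) (fun i => (s i).indicator f), ENNReal.ofReal_prod_of_nonneg
    (fun i _ => integral_nonneg fun y => Set.indicator_nonneg (fun y _ => hf0 y) _)]
  refine Finset.prod_congr rfl fun i _ => ?_
  rw [withDensity_apply _ (hs i), integral_indicator (hs i),
    ofReal_integral_eq_lintegral_ofReal hf.integrableOn (ae_of_all _ hf0)]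

end Product

/-! ### Minimax bound from a mixture of i.i.d. laws. -/

section Mixture

variable {D : ℕ} {ν : Measure (Space D)} [IsProbabilityMeasure ν]

theorem mse_eq_lintegral (ψ : HilbertBasis (Freq D) ℂ (Lp ℂ 2 ν)) (I : Set (Freq D))
    (a : Freq D → ℝ) (n : ℕ) (S : (Fin n → Space D) → ℂ) (hS : Measurable S)
    (h : Space D → ℝ) (hm : Measurable h) (hi : Integrable h ν) (h0 : 0 ≤ h) :
    mse ψ I a n S h = ∫⁻ x, ENNReal.ofReal (‖S x - ((seminormSq ψ I a h).toReal : ℂ)‖ ^ 2)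
      * ENNReal.ofReal (∏ i, h (x i)) ∂(Measure.pi fun _ : Fin n => ν) := by
  rw [mse, sampleLaw, pi_withDensity_ofReal ν h hi h0,
    lintegral_withDensity_eq_lintegral_mul _ (by fun_prop) (by fun_prop)]
  simp only [Pi.mul_apply, mul_comm]

/-- A lower bound on the minimax risk from a density `h₀` and a finite family of densities with a
common value of the estimand, whose uniform mixture is close to `h₀` in chi-square divergence. -/
theorem minimaxRisk_ge_of_mixture (ψ : HilbertBasis (Freq D) ℂ (Lp ℂ 2 ν)) (I : Set (Freq D))
    (a b : Freq D → ℝ) (n : ℕ) {ι : Type*} (Θ : Finset ι) (hΘ : Θ.Nonempty)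
    (h₀ : Space D → ℝ) (h : ι → Space D → ℝ)
    (hm₀ : Measurable h₀) (hm : ∀ θ ∈ Θ, Measurable (h θ))
    (lo₀ : ∀ x, 1 / 2 ≤ h₀ x) (up : ∀ θ ∈ Θ, ∀ x, h θ x ≤ 2)
    (lo : ∀ θ ∈ Θ, ∀ x, 0 ≤ h θ x)
    (hmem₀ : h₀ ∈ densityBall ψ I a b) (hmem : ∀ θ ∈ Θ, h θ ∈ densityBall ψ I a b)
    (t₀ t₁ : ℝ) (ht₀ : (seminormSq ψ I a h₀).toReal = t₀)
    (ht₁ : ∀ θ ∈ Θ, (seminormSq ψ I a (h θ)).toReal = t₁) {C : ℝ}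
    (hC : ∑ θ ∈ Θ, ∑ θ' ∈ Θ, (∫ x, h θ x * h θ' x / h₀ x ∂ν) ^ n ≤ C * (Θ.card : ℝ) ^ 2) :
    ENNReal.ofReal ((t₁ - t₀) ^ 2 / (2 * (1 + C))) ≤ minimaxRisk ψ I a b n := by
  have hN : (0 : ℝ) < Θ.card := by exact_mod_cast hΘ.card_pos
  have pos₀ : ∀ x, 0 < h₀ x := fun x => by linarith [lo₀ x]
  have hC0 : 0 ≤ C := by
    have : 0 ≤ C * (Θ.card : ℝ) ^ 2 := le_trans (Finset.sum_nonneg fun θ hθ =>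
      Finset.sum_nonneg fun θ' hθ' => pow_nonneg (integral_nonneg fun x =>
        div_nonneg (mul_nonneg (lo θ hθ x) (lo θ' hθ' x)) (pos₀ x).le) _) hC
    exact nonneg_of_mul_nonneg_left this (by positivity)
  have hint : ∀ θ ∈ Θ, Integrable (h θ) ν := fun θ hθ => (hmem θ hθ).1.integrable (by norm_num)
  have hint₂ : ∀ θ ∈ Θ, ∀ θ' ∈ Θ, Integrable (fun x => h θ x * h θ' x / h₀ x) ν := by
    intro θ hθ θ' hθ'
    have := hm θ hθ
    have := hm θ' hθ'
    refine Integrable.of_bound (C := 8) (by exact Measurable.aestronglyMeasurable (by fun_prop)) (ae_of_all _ fun x => ?_)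
    have n1 := lo θ hθ x
    have n2 := lo θ' hθ' x
    rw [Real.norm_of_nonneg (div_nonneg (mul_nonneg n1 n2) (pos₀ x).le), div_le_iff₀ (pos₀ x)]
    nlinarith [up θ hθ x, up θ' hθ' x, lo₀ x]
  rw [minimaxRisk]
  refine le_iInf₂ fun S hS => ?_
  set R := ⨆ h ∈ densityBall ψ I a b, mse ψ I a n S h with hR
  set Q : Measure (Fin n → Space D) := Measure.pi fun _ => ν with hQ
  have hmp : ∀ θ ∈ Θ, Measurable fun x : Fin n → Space D => ∏ i, h θ (x i) := fun θ hθ =>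
    Finset.measurable_prod _ fun i _ => (hm θ hθ).comp (measurable_pi_apply i)
  have hnp : ∀ θ ∈ Θ, ∀ x : Fin n → Space D, 0 ≤ ∏ i, h θ (x i) := fun θ hθ x =>
    Finset.prod_nonneg fun i _ => lo θ hθ (x i)
  refine le_cam_chiSq Q (fun x => ∏ i, h₀ (x i))
    (fun x => (Θ.card : ℝ)⁻¹ * ∑ θ ∈ Θ, ∏ i, h θ (x i)) (by fun_prop)
    ((Finset.measurable_sum _ hmp).const_mul _)
    (fun x => Finset.prod_pos fun i _ => pos₀ (x i))
    (fun x => mul_nonneg (by positivity) (Finset.sum_nonneg fun θ hθ => hnp θ hθ x)) ?_ hC0 ?_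
    S hS t₀ t₁ R ?_ ?_
  · have e : ∀ x : Fin n → Space D, ENNReal.ofReal ((Θ.card : ℝ)⁻¹ * ∑ θ ∈ Θ, ∏ i, h θ (x i))
        = ENNReal.ofReal (Θ.card : ℝ)⁻¹ * ∑ θ ∈ Θ, ENNReal.ofReal (∏ i, h θ (x i)) := by
      intro x
      rw [ENNReal.ofReal_mul (by positivity),
        ENNReal.ofReal_sum_of_nonneg fun θ hθ => hnp θ hθ x]
    simp_rw [e]
    rw [lintegral_const_mul _ (Finset.measurable_sum _ fun θ hθ => (hmp θ hθ).ennreal_ofReal),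
      lintegral_finsetSum _ fun θ hθ => (hmp θ hθ).ennreal_ofReal]
    rw [Finset.sum_congr rfl fun θ hθ => by
      rw [lintegral_pi_ofReal_prod ν (h θ) (hint θ hθ) (lo θ hθ), (hmem θ hθ).2.2.1, one_pow,
        ENNReal.ofReal_one]]
    rw [Finset.sum_const, nsmul_eq_mul, mul_one, ENNReal.ofReal_inv_of_pos hN,
      ENNReal.ofReal_natCast, ENNReal.inv_mul_cancel (by simpa using hΘ.ne_empty) (by simp)]
  -- The square of the mixture expands into pairs `(θ, θ')`, and each pair factorizes over the
  -- samples, giving an `n`-th power.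
  · have e : ∀ x : Fin n → Space D,
        ((Θ.card : ℝ)⁻¹ * ∑ θ ∈ Θ, ∏ i, h θ (x i)) ^ 2 / ∏ i, h₀ (x i)
        = ((Θ.card : ℝ) ^ 2)⁻¹ * ∑ θ ∈ Θ, ∑ θ' ∈ Θ, ∏ i, (h θ (x i) * h θ' (x i) / h₀ (x i)) := by
      intro x
      simp_rw [Finset.prod_div_distrib, Finset.prod_mul_distrib, ← Finset.sum_div]
      rw [← Finset.sum_mul_sum]
      ring
    have hi : Integrable (fun x : Fin n → Space D => ((Θ.card : ℝ) ^ 2)⁻¹ *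
        ∑ θ ∈ Θ, ∑ θ' ∈ Θ, ∏ i, (h θ (x i) * h θ' (x i) / h₀ (x i))) Q :=
      (integrable_finsetSum _ fun θ hθ => integrable_finsetSum _ fun θ' hθ' =>
        Integrable.fintype_prod (f := fun _ y => h θ y * h θ' y / h₀ y)
          fun _ => hint₂ θ hθ θ' hθ').const_mul _
    simp_rw [e]
    rw [← ofReal_integral_eq_lintegral_ofReal hi (ae_of_all _ fun x => ?_)]
    · refine ENNReal.ofReal_le_ofReal ?_
      rw [integral_const_mul, integral_finsetSum _ fun θ hθ => integrable_finsetSum _ fun θ' hθ' =>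
        Integrable.fintype_prod (f := fun _ y => h θ y * h θ' y / h₀ y)
          fun _ => hint₂ θ hθ θ' hθ']
      rw [Finset.sum_congr rfl fun θ hθ => integral_finsetSum _ fun θ' hθ' =>
        Integrable.fintype_prod (f := fun _ y => h θ y * h θ' y / h₀ y)
          fun _ => hint₂ θ hθ θ' hθ']
      rw [inv_mul_le_iff₀ (by positivity), mul_comm _ C]
      refine le_trans (le_of_eq ?_) hC
      refine Finset.sum_congr rfl fun θ hθ => Finset.sum_congr rfl fun θ' hθ' => ?_
      rw [integral_fintype_prod_eq_pow (ι := Fin n) (fun y => h θ y * h θ' y / h₀ y), Fintype.card_fin]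
    · exact mul_nonneg (by positivity) (Finset.sum_nonneg fun θ hθ =>
        Finset.sum_nonneg fun θ' hθ' => Finset.prod_nonneg fun i _ =>
          div_nonneg (mul_nonneg (lo θ hθ _) (lo θ' hθ' _)) (pos₀ _).le)
  · have := mse_eq_lintegral ψ I a n S hS h₀ hm₀ (hmem₀.1.integrable (by norm_num))
      fun x => (pos₀ x).le
    rw [ht₀] at this
    rw [← this]
    exact le_iSup₂ (f := fun h _ => mse ψ I a n S h) h₀ hmem₀
  -- Since `t₁` is common to all `θ`, the risk under the mixture is the average of the individual
  -- risks, hence at most `R`.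
  · have e : ∀ x : Fin n → Space D, ENNReal.ofReal (‖S x - t₁‖ ^ 2)
        * ENNReal.ofReal ((Θ.card : ℝ)⁻¹ * ∑ θ ∈ Θ, ∏ i, h θ (x i))
        = ENNReal.ofReal (Θ.card : ℝ)⁻¹ * ∑ θ ∈ Θ, ENNReal.ofReal (‖S x - t₁‖ ^ 2)
          * ENNReal.ofReal (∏ i, h θ (x i)) := by
      intro x
      rw [ENNReal.ofReal_mul (by positivity),
        ENNReal.ofReal_sum_of_nonneg fun θ hθ => hnp θ hθ x, ← Finset.mul_sum]
      ring
    simp_rw [e]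
    have hmm : ∀ θ ∈ Θ, Measurable fun x : Fin n → Space D => ENNReal.ofReal (‖S x - t₁‖ ^ 2)
          * ENNReal.ofReal (∏ i, h θ (x i)) := fun θ hθ =>
      Measurable.mul (by fun_prop) (hmp θ hθ).ennreal_ofReal
    rw [lintegral_const_mul _ (Finset.measurable_sum _ hmm), lintegral_finsetSum _ hmm]
    calc _ ≤ ENNReal.ofReal (Θ.card : ℝ)⁻¹ * ∑ θ ∈ Θ, R := by
          gcongr with θ hθ
          have := mse_eq_lintegral ψ I a n S hS (h θ) (hm θ hθ) (hint θ hθ) (lo θ hθ)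
          rw [ht₁ θ hθ] at this
          rw [← this]
          exact le_iSup₂ (f := fun h _ => mse ψ I a n S h) (h θ) (hmem θ hθ)
      _ = R := by
          rw [Finset.sum_const, nsmul_eq_mul, ← mul_assoc, ENNReal.ofReal_inv_of_pos hN,
            ENNReal.ofReal_natCast, ENNReal.inv_mul_cancel (by simpa using hΘ.ne_empty) (by simp),
            one_mul]

end Mixture

/-! ### Real perturbations of the uniform density and their coefficients. -/

section ConjSystem

variable {D : ℕ} {ν : Measure (Space D)}

/-- A Hilbert basis containing the constant `1`, uniformly bounded by `M`, on which complex
conjugation acts as the norm-preserving permutation `σ` of the indices. -/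
structure IsConjSystem (ψ : HilbertBasis (Freq D) ℂ (Lp ℂ 2 ν)) (M : ℝ)
    (σ : Freq D → Freq D) : Prop where
  nonneg : 0 ≤ M
  one : ∀ᵐ x ∂ν, ψ 0 x = 1
  bound : ∀ z, ∀ᵐ x ∂ν, ‖ψ z x‖ ≤ M
  norm_conj : ∀ z, ‖σ z‖ = ‖z‖
  conj : ∀ z, ∀ᵐ x ∂ν, ψ (σ z) x = (starRingEnd ℂ) (ψ z x)

/-- The representative of `ψ z` that is set to zero where it exceeds `M`. -/
def boundedRep (ψ : HilbertBasis (Freq D) ℂ (Lp ℂ 2 ν)) (M : ℝ) (z : Freq D) (x : Space D) : ℂ :=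
  if ‖ψ z x‖ ≤ M then ψ z x else 0

/-- The real function `Re ψ_z + Im ψ_z`; for the Fourier basis, the Hartley basis. -/
def cas (ψ : HilbertBasis (Freq D) ℂ (Lp ℂ 2 ν)) (M : ℝ) (z : Freq D) (x : Space D) : ℝ :=
  (boundedRep ψ M z x).re + (boundedRep ψ M z x).im

/-- The perturbation `1 + ∑_{z ∈ K} c_z cas_z` of the uniform density. -/
def perturb (ψ : HilbertBasis (Freq D) ℂ (Lp ℂ 2 ν)) (M : ℝ) (K : Finset (Freq D))
    (c : Freq D → ℝ) (x : Space D) : ℝ :=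
  1 + ∑ z ∈ K, c z * cas ψ M z x

variable {ψ : HilbertBasis (Freq D) ℂ (Lp ℂ 2 ν)} {M : ℝ} {σ : Freq D → Freq D}

@[fun_prop]
theorem measurable_boundedRep (z : Freq D) : Measurable (boundedRep ψ M z) :=
  have h : Measurable (ψ z) := (Lp.stronglyMeasurable (ψ z)).measurable
  Measurable.ite (measurableSet_le h.norm measurable_const) h measurable_const

@[fun_prop]
theorem measurable_cas (z : Freq D) : Measurable (cas ψ M z) :=
  (Complex.measurable_re.comp (measurable_boundedRep z)).add
    (Complex.measurable_im.comp (measurable_boundedRep z))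

theorem measurable_perturb (K : Finset (Freq D)) (c : Freq D → ℝ) :
    Measurable (perturb ψ M K c) :=
  measurable_const.add (Finset.measurable_sum _ fun _ _ => (measurable_cas _).const_mul _)

theorem integral_mul_conj (z w : Freq D) :
    ∫ x, ψ w x * (starRingEnd ℂ) (ψ z x) ∂ν = if w = z then 1 else 0 := by
  have h := orthonormal_iff_ite.1 ψ.orthonormal z w
  rw [L2.inner_def] at h
  simp only [RCLike.inner_apply] at h
  rw [h]
  simp only [eq_comm]

namespace IsConjSystem

variable (H : IsConjSystem ψ M σ)
include H

theorem boundedRep_ae (z : Freq D) : boundedRep ψ M z =ᵐ[ν] ψ z := by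
  filter_upwards [H.bound z] with x hx
  rw [boundedRep, if_pos hx]

theorem norm_boundedRep_le (z : Freq D) (x : Space D) : ‖boundedRep ψ M z x‖ ≤ M := by
  rw [boundedRep]
  split_ifs with h
  · exact h
  · simpa using H.nonneg

theorem abs_cas_le (z : Freq D) (x : Space D) : |cas ψ M z x| ≤ 2 * M := by
  have h := H.norm_boundedRep_le z x
  have h1 := Complex.abs_re_le_norm (boundedRep ψ M z x)
  have h2 := Complex.abs_im_le_norm (boundedRep ψ M z x)
  have h3 := abs_add_le (boundedRep ψ M z x).re (boundedRep ψ M z x).im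
  rw [cas]
  linarith

/-- Conjugating twice returns the same basis vector, and an orthonormal family is injective. -/
theorem conj_conj (z : Freq D) : σ (σ z) = z := by
  refine ψ.orthonormal.linearIndependent.injective (Lp.ext ?_)
  filter_upwards [H.conj z, H.conj (σ z)] with x h1 h2
  rw [h2, h1, Complex.conj_conj]

theorem conj_eq_iff (z w : Freq D) : σ w = z ↔ w = σ z :=
  ⟨fun h => by rw [← h, H.conj_conj], fun h => by rw [h, H.conj_conj]⟩

theorem abs_perturb_sub_one_le (K : Finset (Freq D)) (c : Freq D → ℝ) {t : ℝ}
    (hc : ∀ z ∈ K, |c z| = t) (x : Space D) :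
    |perturb ψ M K c x - 1| ≤ K.card * (t * (2 * M)) := by
  rw [perturb, add_sub_cancel_left]
  refine (Finset.abs_sum_le_sum_abs _ _).trans ((Finset.sum_le_card_nsmul _ _ _ fun z hz => ?_).trans
    (le_of_eq (nsmul_eq_mul _ _)))
  rw [abs_mul, hc z hz]
  exact mul_le_mul_of_nonneg_left (H.abs_cas_le z x) (hc z hz ▸ abs_nonneg _)

theorem coeff_one (z : Freq D) : coeff ψ (fun _ => 1) z = if z = 0 then 1 else 0 := by
  have h := integral_mul_conj (ψ := ψ) z 0
  rw [coeff]
  simp only [eq_comm (a := z), ← h]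
  refine integral_congr_ae ?_
  filter_upwards [H.one] with x hx
  simp [hx]

variable [IsProbabilityMeasure ν]

theorem integrable_cas_mul (z w : Freq D) :
    Integrable (fun x => (cas ψ M w x : ℂ) * (starRingEnd ℂ) (ψ z x)) ν := by
  have h : Integrable (fun x => (cas ψ M w x : ℂ) * (starRingEnd ℂ) (boundedRep ψ M z x)) ν := by
    refine Integrable.of_bound (C := 2 * M * M) (Measurable.aestronglyMeasurable ?_)
      (ae_of_all _ fun x => ?_)
    · exact Measurable.mul (by fun_prop) (Complex.continuous_conj.measurable.comp (by fun_prop))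
    · rw [norm_mul, Complex.norm_real, Real.norm_eq_abs, RCLike.norm_conj]
      exact mul_le_mul (H.abs_cas_le w x) (H.norm_boundedRep_le z x) (norm_nonneg _)
        (by linarith [H.nonneg])
  refine h.congr ?_
  filter_upwards [H.boundedRep_ae z] with x hx
  rw [hx]

/-- Almost everywhere `cas_w = (1 - i)/2 ψ_w + (1 + i)/2 ψ_(σ w)`. The two terms merge when `σ w =
w`. -/
theorem coeff_cas (z w : Freq D) : coeff ψ (cas ψ M w) z
    = ((if w = z then 1 - Complex.I else 0) + (if σ w = z then 1 + Complex.I else 0)) / 2 := by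
  have hi : ∀ w, Integrable (fun x => ψ w x * (starRingEnd ℂ) (ψ z x)) ν := by
    intro w
    have h : Integrable (fun x => boundedRep ψ M w x * (starRingEnd ℂ) (boundedRep ψ M z x)) ν := by
      refine Integrable.of_bound (C := M * M) (Measurable.aestronglyMeasurable ?_)
        (ae_of_all _ fun x => ?_)
      · exact Measurable.mul (by fun_prop) (Complex.continuous_conj.measurable.comp (by fun_prop))
      · rw [norm_mul, RCLike.norm_conj]
        exact mul_le_mul (H.norm_boundedRep_le w x) (H.norm_boundedRep_le z x) (norm_nonneg _)
          H.nonneg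
    refine h.congr ?_
    filter_upwards [H.boundedRep_ae z, H.boundedRep_ae w] with x h1 h2
    rw [h1, h2]
  have e : (fun x => (cas ψ M w x : ℂ) * (starRingEnd ℂ) (ψ z x)) =ᵐ[ν]
      fun x => (1 - Complex.I) / 2 * (ψ w x * (starRingEnd ℂ) (ψ z x))
        + (1 + Complex.I) / 2 * (ψ (σ w) x * (starRingEnd ℂ) (ψ z x)) := by
    filter_upwards [H.boundedRep_ae w, H.conj w] with x h1 h2
    have : ((cas ψ M w x : ℝ) : ℂ)
        = (1 - Complex.I) / 2 * ψ w x + (1 + Complex.I) / 2 * ψ (σ w) x := by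
      rw [h2, cas, h1]
      apply Complex.ext <;> simp <;> ring
    rw [this]
    ring
  rw [coeff, integral_congr_ae e, integral_add ((hi w).const_mul _) ((hi (σ w)).const_mul _),
    integral_const_mul, integral_const_mul, integral_mul_conj, integral_mul_conj]
  split_ifs <;> ring

theorem integral_cas {z : Freq D} (hz : z ≠ 0) : ∫ x, cas ψ M z x ∂ν = 0 := by
  have h := H.coeff_cas 0 z
  have hz' : σ z ≠ 0 := by rw [← norm_ne_zero_iff, H.norm_conj, norm_ne_zero_iff]; exact hz
  rw [if_neg hz, if_neg hz', coeff] at h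
  have e : ∫ x, (cas ψ M z x : ℂ) * (starRingEnd ℂ) (ψ 0 x) ∂ν = ∫ x, (cas ψ M z x : ℂ) ∂ν := by
    refine integral_congr_ae ?_
    filter_upwards [H.one] with x hx
    simp [hx]
  rw [e, integral_complex_ofReal] at h
  simpa using h

/-- As `cas_z = Re ((1 + i) conj ψ_z)`, the integral is the real part of `(1 + i)` times a
coefficient of `cas_w`. The `σ w = z` term contributes `(1 + i)²/2 = i`, which has no real part, so
conjugate pairs are orthogonal too. -/
theorem integral_cas_mul_cas (z w : Freq D) :
    ∫ x, cas ψ M w x * cas ψ M z x ∂ν = if w = z then 1 else 0 := by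
  have e : (fun x => cas ψ M w x * cas ψ M z x) =ᵐ[ν]
      fun x => ((1 + Complex.I) * ((cas ψ M w x : ℂ) * (starRingEnd ℂ) (ψ z x))).re := by
    filter_upwards [H.boundedRep_ae z] with x hx
    have : cas ψ M z x = (ψ z x).re + (ψ z x).im := by rw [cas, hx]
    rw [this]
    simp
    ring
  have h := integral_re ((H.integrable_cas_mul z w).const_mul (1 + Complex.I))
  simp only [RCLike.re_eq_complex_re] at h
  rw [integral_congr_ae e, h, integral_const_mul]
  change ((1 + Complex.I) * coeff ψ (cas ψ M w) z).re = _
  rw [H.coeff_cas]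
  split_ifs <;> (simp; try norm_num)

theorem integrable_cas (z : Freq D) : Integrable (cas ψ M z) ν :=
  Integrable.of_bound (C := 2 * M) (measurable_cas z).aestronglyMeasurable
    (ae_of_all _ fun x => H.abs_cas_le z x)

theorem integral_perturb {K : Finset (Freq D)} (hK : 0 ∉ K) (c : Freq D → ℝ) :
    ∫ x, perturb ψ M K c x ∂ν = 1 := by
  simp only [perturb]
  rw [integral_add (integrable_const _) (integrable_finsetSum _ fun z _ =>
      (H.integrable_cas z).const_mul _),
    integral_finsetSum _ fun z _ => (H.integrable_cas z).const_mul _]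
  rw [Finset.sum_eq_zero fun z hz => by
    rw [integral_const_mul, H.integral_cas (fun h => hK (h ▸ hz)), mul_zero]]
  simp

theorem integral_sum_mul_sum (K : Finset (Freq D)) (c d : Freq D → ℝ) :
    ∫ x, (∑ z ∈ K, c z * cas ψ M z x) * (∑ z ∈ K, d z * cas ψ M z x) ∂ν = ∑ z ∈ K, c z * d z := by
  have hi : ∀ z w, Integrable (fun x => c z * cas ψ M z x * (d w * cas ψ M w x)) ν := by
    intro z w
    refine Integrable.of_bound (C := |c z| * (2 * M) * (|d w| * (2 * M)))
      (Measurable.aestronglyMeasurable (by fun_prop)) (ae_of_all _ fun x => ?_)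
    rw [Real.norm_eq_abs, abs_mul, abs_mul, abs_mul]
    have := H.nonneg
    gcongr
    · exact H.abs_cas_le z x
    · exact H.abs_cas_le w x
  simp_rw [Finset.sum_mul_sum]
  rw [integral_finsetSum _ fun z _ => integrable_finsetSum _ fun w _ => hi z w]
  refine Finset.sum_congr rfl fun z hz => ?_
  rw [integral_finsetSum _ fun w _ => hi z w]
  have e : ∀ w, ∫ x, c z * cas ψ M z x * (d w * cas ψ M w x) ∂ν
      = if z = w then c z * d w else 0 := by
    intro w
    have : ∀ x, c z * cas ψ M z x * (d w * cas ψ M w x)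
        = c z * d w * (cas ψ M z x * cas ψ M w x) := fun x => by ring
    simp_rw [this]
    rw [integral_const_mul, H.integral_cas_mul_cas]
    split_ifs <;> simp
  simp_rw [e]
  rw [Finset.sum_ite_eq, if_pos hz]

theorem integral_perturb_mul_perturb {K : Finset (Freq D)} (hK : 0 ∉ K) (c d : Freq D → ℝ) :
    ∫ x, perturb ψ M K c x * perturb ψ M K d x ∂ν = 1 + ∑ z ∈ K, c z * d z := by
  have h1 : ∀ c : Freq D → ℝ, Integrable (perturb ψ M K c) ν := fun c =>
    (integrable_const _).add (integrable_finsetSum _ fun z _ => (H.integrable_cas z).const_mul _)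
  have h2 : Integrable (fun x =>
      (∑ z ∈ K, c z * cas ψ M z x) * (∑ z ∈ K, d z * cas ψ M z x)) ν := by
    refine Integrable.of_bound (C := (∑ z ∈ K, |c z| * (2 * M)) * (∑ z ∈ K, |d z| * (2 * M)))
      (Measurable.aestronglyMeasurable (by fun_prop)) (ae_of_all _ fun x => ?_)
    have hs : ∀ c : Freq D → ℝ, ‖∑ z ∈ K, c z * cas ψ M z x‖ ≤ ∑ z ∈ K, |c z| * (2 * M) := by
      intro c
      refine norm_sum_le_of_le _ fun z _ => ?_
      rw [Real.norm_eq_abs, abs_mul]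
      exact mul_le_mul_of_nonneg_left (H.abs_cas_le z x) (abs_nonneg _)
    rw [norm_mul]
    exact mul_le_mul (hs c) (hs d) (norm_nonneg _) ((norm_nonneg _).trans (hs c))
  have e : ∀ x, perturb ψ M K c x * perturb ψ M K d x = perturb ψ M K c x + perturb ψ M K d x - 1
      + (∑ z ∈ K, c z * cas ψ M z x) * (∑ z ∈ K, d z * cas ψ M z x) := fun x => by
    simp only [perturb]; ring
  have h3 : Integrable (fun x => perturb ψ M K c x + perturb ψ M K d x) ν := (h1 c).add (h1 d)
  have h4 : Integrable (fun x => perturb ψ M K c x + perturb ψ M K d x - 1) ν :=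
    h3.sub (integrable_const _)
  simp_rw [e]
  rw [integral_add h4 h2, integral_sub h3 (integrable_const _), integral_add (h1 c) (h1 d),
    H.integral_perturb hK, H.integral_perturb hK, H.integral_sum_mul_sum]
  simp

theorem coeff_perturb (K : Finset (Freq D)) (hσ : ∀ z ∈ K, σ z ∈ K) (c : Freq D → ℝ)
    (z : Freq D) : coeff ψ (perturb ψ M K c) z = (if z = 0 then 1 else 0)
      + if z ∈ K then (c z * (1 - Complex.I) + c (σ z) * (1 + Complex.I)) / 2 else 0 := by
  have e : ∀ x, ((perturb ψ M K c x : ℝ) : ℂ) * (starRingEnd ℂ) (ψ z x)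
      = ((1 : ℝ) : ℂ) * (starRingEnd ℂ) (ψ z x)
        + ∑ w ∈ K, (c w : ℂ) * ((cas ψ M w x : ℂ) * (starRingEnd ℂ) (ψ z x)) := by
    intro x
    rw [perturb]
    push_cast
    rw [add_mul, Finset.sum_mul]
    simp only [mul_assoc]
  have h1 : Integrable (fun x => ((1 : ℝ) : ℂ) * (starRingEnd ℂ) (ψ z x)) ν := by
    have h : Integrable (ψ z) ν := (Lp.memLp (ψ z)).integrable (by norm_num)
    simpa using (Complex.conjCLE.integrable_comp_iff (φ := ψ z)).2 h
  rw [coeff]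
  simp_rw [e]
  rw [integral_add h1 (integrable_finsetSum _ fun w _ => (H.integrable_cas_mul z w).const_mul _),
    integral_finsetSum _ fun w _ => (H.integrable_cas_mul z w).const_mul _]
  congr 1
  · exact H.coeff_one z
  · have e2 : ∀ w, ∫ x, (c w : ℂ) * ((cas ψ M w x : ℂ) * (starRingEnd ℂ) (ψ z x)) ∂ν
        = (if w = z then c w * (1 - Complex.I) / 2 else 0)
          + (if w = σ z then c w * (1 + Complex.I) / 2 else 0) := by
      intro w
      rw [integral_const_mul]
      change (c w : ℂ) * coeff ψ (cas ψ M w) z = _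
      rw [H.coeff_cas]
      simp only [H.conj_eq_iff]
      split_ifs <;> ring
    simp_rw [e2]
    rw [Finset.sum_add_distrib, Finset.sum_ite_eq', Finset.sum_ite_eq']
    have : σ z ∈ K ↔ z ∈ K := ⟨fun h => by simpa [H.conj_conj] using hσ _ h, hσ z⟩
    simp only [this]
    split_ifs <;> ring

/-- On `K` the squared modulus is `(c_z² + c_(σ z)²) / 2`: the cross terms cancel. Hence the signs
of `c` can be chosen independently, even within a conjugate pair, without affecting any seminorm. -/
theorem normSq_coeff_perturb {K : Finset (Freq D)} (hK : 0 ∉ K) (hσ : ∀ z ∈ K, σ z ∈ K)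
    {c : Freq D → ℝ} {t : ℝ} (hc : ∀ z ∈ K, |c z| = t) (z : Freq D) :
    ‖coeff ψ (perturb ψ M K c) z‖ ^ 2 = (if z = 0 then 1 else 0) + if z ∈ K then t ^ 2 else 0 := by
  rw [H.coeff_perturb K hσ]
  by_cases hz : z ∈ K
  · have hz0 : z ≠ 0 := fun h => hK (h ▸ hz)
    have h1 : c z ^ 2 = t ^ 2 := by rw [← sq_abs, hc z hz]
    have h2 : c (σ z) ^ 2 = t ^ 2 := by rw [← sq_abs, hc _ (hσ z hz)]
    simp only [hz0, hz, if_true, if_false, zero_add]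
    rw [Complex.sq_norm, Complex.normSq_apply]
    simp
    linear_combination h1 / 2 + h2 / 2
  · simp only [hz, if_false, add_zero]
    split_ifs <;> simp

theorem seminormSq_perturb {K : Finset (Freq D)} (hK : 0 ∉ K) (hσ : ∀ z ∈ K, σ z ∈ K)
    {c : Freq D → ℝ} {t : ℝ} (hc : ∀ z ∈ K, |c z| = t) (I : Set (Freq D)) (w : Freq D → ℝ) :
    seminormSq ψ I w (perturb ψ M K c) = ENNReal.ofReal (I.indicator (fun z => (w z ^ 2)⁻¹) 0
      + t ^ 2 * ∑ z ∈ K, I.indicator (fun z => (w z ^ 2)⁻¹) z) := by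
  classical
  rw [seminormSq, tsum_subtype I
    fun z => ENNReal.ofReal (‖coeff ψ (perturb ψ M K c) z‖ ^ 2 / w z ^ 2)]
  have e : ∀ z, I.indicator
      (fun z => ENNReal.ofReal (‖coeff ψ (perturb ψ M K c) z‖ ^ 2 / w z ^ 2)) z
      = ENNReal.ofReal (((if z = 0 then 1 else 0) + if z ∈ K then t ^ 2 else 0)
        * I.indicator (fun z => (w z ^ 2)⁻¹) z) := by
    intro z
    by_cases hz : z ∈ I
    · rw [Set.indicator_of_mem hz, Set.indicator_of_mem hz, H.normSq_coeff_perturb hK hσ hc,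
        div_eq_mul_inv]
    · rw [Set.indicator_of_notMem hz, Set.indicator_of_notMem hz, mul_zero, ENNReal.ofReal_zero]
  have nn : ∀ z, 0 ≤ I.indicator (fun z => (w z ^ 2)⁻¹) z :=
    fun z => Set.indicator_nonneg (fun z _ => by positivity) z
  simp_rw [e]
  rw [tsum_eq_sum (s := insert 0 K)]
  · rw [← ENNReal.ofReal_sum_of_nonneg, Finset.sum_insert hK]
    · congr 2
      · simp [hK]
      · rw [Finset.mul_sum]
        refine Finset.sum_congr rfl fun z hz => ?_
        have hz0 : z ≠ 0 := fun h => hK (h ▸ hz)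
        simp [hz, hz0]
    · intro z _
      refine mul_nonneg ?_ (nn z)
      split_ifs <;> positivity
  · intro z hz
    rw [Finset.mem_insert, not_or] at hz
    simp [hz.1, hz.2]

theorem perturb_mem_densityBall {K : Finset (Freq D)} (hK : 0 ∉ K) (hσ : ∀ z ∈ K, σ z ∈ K)
    {c : Freq D → ℝ} {t : ℝ} (hc : ∀ z ∈ K, |c z| = t) (I : Set (Freq D)) (a b : Freq D → ℝ)
    (hpos : K.card * (t * (2 * M)) ≤ 1)
    (hb : I.indicator (fun z => (b z ^ 2)⁻¹) 0
      + t ^ 2 * ∑ z ∈ K, I.indicator (fun z => (b z ^ 2)⁻¹) z ≤ 1) :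
    perturb ψ M K c ∈ densityBall ψ I a b := by
  have h := H.abs_perturb_sub_one_le K c hc
  refine ⟨?_, ae_of_all _ fun x => ?_, H.integral_perturb hK c, ?_, ?_⟩
  · refine MemLp.of_bound (measurable_perturb K c).aestronglyMeasurable 2 (ae_of_all _ fun x => ?_)
    rw [Real.norm_eq_abs, abs_le]
    have := abs_le.1 (h x)
    constructor <;> linarith
  · have := abs_le.1 (h x)
    simp only [Pi.zero_apply]
    linarith
  · rw [H.seminormSq_perturb hK hσ hc]
    exact ENNReal.ofReal_le_one.2 hb
  · rw [H.seminormSq_perturb hK hσ hc]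
    exact ENNReal.ofReal_lt_top

theorem toReal_seminormSq_perturb {K : Finset (Freq D)} (hK : 0 ∉ K) (hσ : ∀ z ∈ K, σ z ∈ K)
    {c : Freq D → ℝ} {t : ℝ} (hc : ∀ z ∈ K, |c z| = t) (I : Set (Freq D)) (w : Freq D → ℝ) :
    (seminormSq ψ I w (perturb ψ M K c)).toReal = I.indicator (fun z => (w z ^ 2)⁻¹) 0
      + t ^ 2 * ∑ z ∈ K, I.indicator (fun z => (w z ^ 2)⁻¹) z := by
  have nn : ∀ z, 0 ≤ I.indicator (fun z => (w z ^ 2)⁻¹) z :=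
    fun z => Set.indicator_nonneg (fun z _ => by positivity) z
  rw [H.seminormSq_perturb hK hσ hc, ENNReal.toReal_ofReal]
  exact add_nonneg (nn 0) (mul_nonneg (sq_nonneg _) (Finset.sum_nonneg fun z _ => nn z))

end IsConjSystem

end ConjSystem

/-! ### Exponential moments of random signs. -/

section Signs

variable {α : Type*} [DecidableEq α]

/-- The moment generating function of a sum of independent random signs. -/
theorem sum_powerset_exp_signs (K : Finset α) (l : α → ℝ) :
    ∑ s ∈ K.powerset, Real.exp (∑ z ∈ K, l z * if z ∈ s then 1 else -1)
      = ∏ z ∈ K, (2 * Real.cosh (l z)) := by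
  have e : ∀ z, 2 * Real.cosh (l z) = Real.exp (l z) + Real.exp (-l z) := fun z => by
    rw [Real.cosh_eq]; ring
  simp_rw [e]
  rw [Finset.prod_add]
  refine Finset.sum_congr rfl fun s hs => ?_
  rw [Real.exp_sum, ← Finset.prod_sdiff (Finset.mem_powerset.1 hs), mul_comm]
  congr 1
  · exact Finset.prod_congr rfl fun z hz => by simp [hz]
  · exact Finset.prod_congr rfl fun z hz => by simp [(Finset.mem_sdiff.1 hz).2]

/-- For fixed `s` the inner sum is a product of factors `2 cosh (± l)`, and `cosh x ≤ exp (x² / 2)`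
does not see the sign, so the bound is uniform in `s`. -/
theorem sum_sum_powerset_exp_signs_le (K : Finset α) (l : ℝ) :
    ∑ s ∈ K.powerset, ∑ s' ∈ K.powerset,
        Real.exp (∑ z ∈ K, l * ((if z ∈ s then 1 else -1) * if z ∈ s' then 1 else -1))
      ≤ Real.exp (K.card * (l ^ 2 / 2)) * (K.powerset.card : ℝ) ^ 2 := by
  have h : ∀ s ∈ K.powerset, ∑ s' ∈ K.powerset,
      Real.exp (∑ z ∈ K, l * ((if z ∈ s then 1 else -1) * if z ∈ s' then 1 else -1))
      ≤ 2 ^ K.card * Real.exp (K.card * (l ^ 2 / 2)) := by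
    intro s _
    simp_rw [← mul_assoc]
    rw [sum_powerset_exp_signs]
    calc _ ≤ ∏ z ∈ K, (2 * Real.exp (l ^ 2 / 2)) := by
          refine Finset.prod_le_prod (fun z _ => by positivity) fun z _ => ?_
          refine mul_le_mul_of_nonneg_left ((Real.cosh_le_exp_half_sq _).trans (le_of_eq ?_))
            (by norm_num)
          split_ifs <;> ring_nf
      _ = _ := by rw [Finset.prod_const, mul_pow, ← Real.exp_nat_mul]
  refine (Finset.sum_le_card_nsmul _ _ _ h).trans (le_of_eq ?_)
  rw [nsmul_eq_mul, Finset.card_powerset]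
  push_cast
  ring

end Signs

/-! ### The two lower bounds for fixed `n`. -/

section LowerBounds

variable {D : ℕ} {ν : Measure (Space D)} [IsProbabilityMeasure ν]
  {ψ : HilbertBasis (Freq D) ℂ (Lp ℂ 2 ν)} {M : ℝ} {σ : Freq D → Freq D}

theorem indicator_inv_sq_nonneg (I : Set (Freq D)) (w : Freq D → ℝ) (z : Freq D) :
    0 ≤ I.indicator (fun z => (w z ^ 2)⁻¹) z :=
  Set.indicator_nonneg (fun z _ => by positivity) z

namespace IsConjSystem

variable (H : IsConjSystem ψ M σ)
include H

/-- The lower bound from random signs on the coefficients of a perturbation of the uniform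
density. -/
theorem minimaxRisk_ge_of_signs {K : Finset (Freq D)} (hK : 0 ∉ K) (hσ : ∀ z ∈ K, σ z ∈ K)
    (I : Set (Freq D)) (a b : Freq D → ℝ) (n : ℕ) {t G : ℝ} (ht : 0 ≤ t)
    (hpos : K.card * (t * (2 * M)) ≤ 1 / 2)
    (hb : I.indicator (fun z => (b z ^ 2)⁻¹) 0
      + t ^ 2 * ∑ z ∈ K, I.indicator (fun z => (b z ^ 2)⁻¹) z ≤ 1)
    (hG : K.card * ((n * t ^ 2) ^ 2 / 2) ≤ G) :
    ENNReal.ofReal ((t ^ 2 * ∑ z ∈ K, I.indicator (fun z => (a z ^ 2)⁻¹) z) ^ 2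
      / (2 * (1 + Real.exp G))) ≤ minimaxRisk ψ I a b n := by
  classical
  set ε : Finset (Freq D) → Freq D → ℝ := fun s z => if z ∈ s then 1 else -1 with hε
  set c : Finset (Freq D) → Freq D → ℝ := fun s z => t * ε s z with hc_def
  have hc : ∀ s, ∀ z ∈ K, |c s z| = t := by
    intro s z _
    simp only [hc_def, hε]
    split_ifs <;> simp [abs_of_nonneg ht]
  have hc0 : ∀ z ∈ K, |(fun _ => 0 : Freq D → ℝ) z| = 0 := fun z _ => abs_zero
  have h1 : ∀ x, perturb ψ M K (fun _ => 0) x = 1 := fun x => by simp [perturb]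
  have habs : ∀ s x, 1 / 2 ≤ perturb ψ M K (c s) x ∧ perturb ψ M K (c s) x ≤ 2 := by
    intro s x
    have := abs_le.1 (H.abs_perturb_sub_one_le K (c s) (hc s) x)
    constructor <;> linarith
  have key := minimaxRisk_ge_of_mixture ψ I a b n K.powerset ⟨∅, by simp⟩
    (perturb ψ M K fun _ => 0) (fun s => perturb ψ M K (c s)) (measurable_perturb K _)
    (fun s _ => measurable_perturb K _) (fun x => by rw [h1]; norm_num)
    (fun s _ x => (habs s x).2) (fun s _ x => by linarith [(habs s x).1])
    (H.perturb_mem_densityBall hK hσ hc0 I a b (by simp) (by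
      have : 0 ≤ t ^ 2 * ∑ z ∈ K, I.indicator (fun z => (b z ^ 2)⁻¹) z :=
        mul_nonneg (sq_nonneg _) (Finset.sum_nonneg fun z _ => indicator_inv_sq_nonneg I b z)
      linarith))
    (fun s _ => H.perturb_mem_densityBall hK hσ (hc s) I a b (by linarith) hb)
    _ _ (H.toReal_seminormSq_perturb hK hσ hc0 I a)
    (fun s _ => H.toReal_seminormSq_perturb hK hσ (hc s) I a) (C := Real.exp G) ?_
  · refine le_trans (le_of_eq ?_) key
    congr 2
    ring
  -- By orthonormality the integral is `1 + t² ∑ ε_z ε'_z`; then `1 + x ≤ exp x` turns the `n`-th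
  -- power into the exponential of a sum of signs.
  · have hle : ∀ s s', (∫ x, perturb ψ M K (c s) x * perturb ψ M K (c s') x
        / perturb ψ M K (fun _ => 0) x ∂ν) ^ n
        ≤ Real.exp (∑ z ∈ K, (n * t ^ 2) * (ε s z * ε s' z)) := by
      intro s s'
      have hnn : 0 ≤ ∫ x, perturb ψ M K (c s) x * perturb ψ M K (c s') x ∂ν :=
        integral_nonneg fun x => mul_nonneg (by linarith [(habs s x).1])
          (by linarith [(habs s' x).1])
      simp_rw [h1, div_one]
      rw [H.integral_perturb_mul_perturb hK] at hnn ⊢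
      refine (pow_le_pow_left₀ hnn ((add_comm _ _).trans_le (Real.add_one_le_exp _)) n).trans
        (le_of_eq ?_)
      rw [← Real.exp_nat_mul, Finset.mul_sum]
      congr 1
      refine Finset.sum_congr rfl fun z _ => ?_
      simp only [hc_def]
      ring
    refine (Finset.sum_le_sum fun s _ => Finset.sum_le_sum fun s' _ => hle s s').trans
      ((sum_sum_powerset_exp_signs_le K _).trans ?_)
    gcongr

/-- The parametric lower bound, from two densities at chi-square distance of order `1 / n`. -/
theorem exists_minimaxRisk_ge_inv {K : Finset (Freq D)} (hK : 0 ∉ K) (hσ : ∀ z ∈ K, σ z ∈ K)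
    (I : Set (Freq D)) (a b : Freq D → ℝ)
    (ha : 0 < ∑ z ∈ K, I.indicator (fun z => (a z ^ 2)⁻¹) z)
    (hb : I.indicator (fun z => (b z ^ 2)⁻¹) 0 < 1) :
    ∃ c : ℝ, 0 < c ∧ ∀ n : ℕ, 0 < n → ENNReal.ofReal (c / n) ≤ minimaxRisk ψ I a b n := by
  set α := I.indicator (fun z => (a z ^ 2)⁻¹) 0 with hα
  set β := I.indicator (fun z => (b z ^ 2)⁻¹) 0 with hβ
  set A := ∑ z ∈ K, I.indicator (fun z => (a z ^ 2)⁻¹) z with hA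
  set B := ∑ z ∈ K, I.indicator (fun z => (b z ^ 2)⁻¹) z with hB
  have hB0 : 0 ≤ B := Finset.sum_nonneg fun z _ => indicator_inv_sq_nonneg I b z
  have hM := H.nonneg
  -- The constraints are imposed at `2 * t` so that both coefficients used below, `t` and `t + t /
  -- √n`, satisfy them.
  obtain ⟨t, ht, ht1, ht2⟩ : ∃ t : ℝ, 0 < t ∧ K.card * (2 * t * (2 * M)) ≤ 1 / 2
      ∧ β + (2 * t) ^ 2 * B ≤ 1 := by
    have e1 : ∀ᶠ t : ℝ in 𝓝 0, K.card * (2 * t * (2 * M)) < 1 / 2 :=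
      ContinuousAt.eventually_lt (by fun_prop) (by fun_prop) (by norm_num)
    have e2 : ∀ᶠ t : ℝ in 𝓝 0, β + (2 * t) ^ 2 * B < 1 :=
      ContinuousAt.eventually_lt (by fun_prop) (by fun_prop) (by simpa using hb)
    have e3 : ∀ᶠ t : ℝ in 𝓝[>] 0, 0 < t := self_mem_nhdsWithin
    obtain ⟨t, h3, h1, h2⟩ := (e3.and ((e1.and e2).filter_mono nhdsWithin_le_nhds)).exists
    exact ⟨t, h3, h1.le, h2.le⟩
  set C := Real.exp (2 * t ^ 2 * K.card) with hC
  refine ⟨(2 * t ^ 2 * A) ^ 2 / (2 * (1 + C)), by positivity, fun n hn => ?_⟩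
  have hn' : (1 : ℝ) ≤ n := by exact_mod_cast hn
  set δ := t / √n with hδ
  have hsq : √(n : ℝ) ^ 2 = n := Real.sq_sqrt (by positivity)
  have hδ0 : 0 < δ := by positivity
  have hδ2 : δ ^ 2 = t ^ 2 / n := by rw [hδ, div_pow, hsq]
  have hδt : δ ≤ t := div_le_self ht.le (Real.one_le_sqrt.2 hn')
  have hpos : ∀ r : ℝ, r ≤ 2 * t → K.card * (r * (2 * M)) ≤ 1 / 2 := fun r hr =>
    le_trans (by gcongr) ht1
  have hball : ∀ r : ℝ, 0 ≤ r → r ≤ 2 * t → β + r ^ 2 * B ≤ 1 := fun r h0 hr =>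
    le_trans (by gcongr) ht2
  have hc : ∀ r : ℝ, 0 ≤ r → ∀ z ∈ K, |(fun _ => r : Freq D → ℝ) z| = r :=
    fun r hr z _ => abs_of_nonneg hr
  have habs : ∀ r : ℝ, 0 ≤ r → r ≤ 2 * t → ∀ x, 1 / 2 ≤ perturb ψ M K (fun _ => r) x
      ∧ perturb ψ M K (fun _ => r) x ≤ 2 := by
    intro r h0 hr x
    have h1 := abs_le.1 (H.abs_perturb_sub_one_le K (fun _ => r) (hc r h0) x)
    have h2 := hpos r hr
    constructor <;> linarith
  have l0 : t ≤ 2 * t := by linarith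
  have s1 : 0 ≤ t + δ := by positivity
  have l1 : t + δ ≤ 2 * t := by linarith
  have key := minimaxRisk_ge_of_mixture ψ I a b n (Finset.univ : Finset Unit)
    Finset.univ_nonempty
    (perturb ψ M K fun _ => t) (fun _ => perturb ψ M K fun _ => t + δ) (measurable_perturb K _)
    (fun _ _ => measurable_perturb K _) (fun x => (habs t ht.le l0 x).1)
    (fun _ _ x => (habs _ s1 l1 x).2) (fun _ _ x => by linarith [(habs _ s1 l1 x).1])
    (H.perturb_mem_densityBall hK hσ (hc t ht.le) I a b (by linarith [hpos t l0])
      (hball t ht.le l0))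
    (fun _ _ => H.perturb_mem_densityBall hK hσ (hc _ s1) I a b (by linarith [hpos _ l1])
      (hball _ s1 l1))
    _ _ (H.toReal_seminormSq_perturb hK hσ (hc t ht.le) I a)
    (fun _ _ => H.toReal_seminormSq_perturb hK hσ (hc _ s1) I a) (C := C) ?_
  · refine le_trans (ENNReal.ofReal_le_ofReal ?_) key
    rw [div_right_comm]
    refine div_le_div_of_nonneg_right ?_ (by positivity)
    have e : (2 * t ^ 2 * A) ^ 2 / n = (2 * t * δ * A) ^ 2 := by
      rw [mul_pow, mul_pow (2 * t * δ), mul_pow (2 * t), hδ2]; ring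
    rw [e]
    refine pow_le_pow_left₀ (by positivity) ?_ 2
    rw [← hα, ← hA]
    nlinarith [mul_nonneg (sq_nonneg δ) ha.le]
  · set h₀ := perturb ψ M K fun _ => t
    set h₁ := perturb ψ M K fun _ => t + δ
    have i0 : ∀ r : ℝ, 0 ≤ r → r ≤ 2 * t → Integrable (perturb ψ M K fun _ => r) ν :=
      fun r hr hr' => Integrable.of_bound (C := 2) (measurable_perturb K _).aestronglyMeasurable
        (ae_of_all _ fun x => by
          rw [Real.norm_eq_abs, abs_le]
          constructor <;> linarith [(habs r hr hr' x).1, (habs r hr hr' x).2])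
    have im : ∀ r r' : ℝ, 0 ≤ r → r ≤ 2 * t → 0 ≤ r' → r' ≤ 2 * t →
        Integrable (fun x => perturb ψ M K (fun _ => r) x * perturb ψ M K (fun _ => r') x) ν :=
      fun r r' hr hr2 hr' hr2' => Integrable.of_bound (C := 4)
        ((measurable_perturb K _).mul (measurable_perturb K _)).aestronglyMeasurable
        (ae_of_all _ fun x => by
          have := habs r hr hr2 x
          have := habs r' hr' hr2' x
          rw [Real.norm_eq_abs, abs_le]
          constructor <;> nlinarith)
    have m0 : Measurable h₀ := measurable_perturb K _
    have m1 : Measurable h₁ := measurable_perturb K _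
    -- `h₁² / h₀ = 2 h₁ - h₀ + (h₁ - h₀)² / h₀`, and `h₀ ≥ 1/2` bounds the last term by `2 (h₁ -
    -- h₀)²`, whose integral is `2 |K| δ²`.
    have hint : ∫ x, h₁ x * h₁ x / h₀ x ∂ν ≤ 1 + 2 * K.card * δ ^ 2 := by
      have j0 : Integrable h₀ ν := i0 t ht.le l0
      have j1 : Integrable (fun x => 2 * h₁ x) ν := (i0 _ s1 l1).const_mul 2
      have j00 : Integrable (fun x => 2 * (h₀ x * h₀ x)) ν := (im t t ht.le l0 ht.le l0).const_mul 2
      have j11 : Integrable (fun x => 2 * (h₁ x * h₁ x)) ν := (im _ _ s1 l1 s1 l1).const_mul 2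
      have j10 : Integrable (fun x => 4 * (h₁ x * h₀ x)) ν := (im _ t s1 l1 ht.le l0).const_mul 4
      have k1 : Integrable (fun x => 2 * h₁ x - h₀ x) ν := j1.sub j0
      have k2 : Integrable (fun x => 2 * h₁ x - h₀ x + 2 * (h₁ x * h₁ x)) ν := k1.add j11
      have k3 : Integrable (fun x => 2 * h₁ x - h₀ x + 2 * (h₁ x * h₁ x) + 2 * (h₀ x * h₀ x)) ν :=
        k2.add j00
      calc ∫ x, h₁ x * h₁ x / h₀ x ∂ν
          ≤ ∫ x, (2 * h₁ x - h₀ x + 2 * (h₁ x * h₁ x) + 2 * (h₀ x * h₀ x)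
            - 4 * (h₁ x * h₀ x)) ∂ν := by
            refine integral_mono_of_nonneg (ae_of_all _ fun x => ?_) (k3.sub j10)
              (ae_of_all _ fun x => ?_)
            · exact div_nonneg (mul_self_nonneg _) (by linarith [(habs t ht.le l0 x).1])
            · have hh := (habs t ht.le l0 x).1
              change 1 / 2 ≤ h₀ x at hh
              simp only
              rw [div_le_iff₀ (by linarith)]
              nlinarith [mul_nonneg (sub_nonneg.2 hh) (sq_nonneg (h₁ x - h₀ x))]
        _ = 1 + 2 * K.card * δ ^ 2 := by
            rw [integral_sub k3 j10, integral_add k2 j00, integral_add k1 j11, integral_sub j1 j0,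
              integral_const_mul, integral_const_mul, integral_const_mul, integral_const_mul,
              H.integral_perturb hK, H.integral_perturb hK, H.integral_perturb_mul_perturb hK,
              H.integral_perturb_mul_perturb hK, H.integral_perturb_mul_perturb hK]
            simp only [Finset.sum_const, nsmul_eq_mul]
            ring
    simp only [Finset.univ_unique, Finset.sum_singleton, Finset.card_singleton, Nat.cast_one,
      one_pow, mul_one]
    refine (pow_le_pow_left₀ (integral_nonneg fun x => div_nonneg (mul_self_nonneg _)
      (by linarith [(habs t ht.le l0 x).1])) (hint.trans
        ((add_comm _ _).trans_le (Real.add_one_le_exp _))) n).trans (le_of_eq ?_)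
    rw [← Real.exp_nat_mul, hC, hδ2]
    congr 1
    field_simp

end IsConjSystem

end LowerBounds

/-! ### From fixed-`n` bounds to rates. -/

section Rates

variable {D : ℕ}

theorem card_box_le {ζ : ℝ} (hζ : 1 ≤ ζ) : ((box D ζ).card : ℝ) ≤ (3 * ζ) ^ D := by
  have hf : (1 : ℤ) ≤ ⌊ζ⌋ := Int.le_floor.2 (by simpa using hζ)
  rw [box, Pi.card_Icc, Finset.prod_congr rfl fun i _ => Int.card_Icc _ _, Finset.prod_const,
    Finset.card_univ, Fintype.card_fin]
  push_cast
  refine pow_le_pow_left₀ (Nat.cast_nonneg _) ?_ D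
  have h : (((⌊ζ⌋ + 1 - -⌊ζ⌋).toNat : ℤ) : ℝ) = ⌊ζ⌋ + 1 + ⌊ζ⌋ := by
    rw [Int.toNat_of_nonneg (by omega)]; push_cast; ring
  rw [Int.cast_natCast] at h
  rw [h]
  linarith [Int.floor_le ζ]

theorem weightSum_eq (I : Set (Freq D)) (w : Freq D → ℝ) {ζ : ℝ} (hζ : 0 ≤ ζ) :
    weightSum I w ζ = I.indicator (fun z => (w z ^ 2)⁻¹) 0
      + ∑ z ∈ (box D ζ).erase 0, I.indicator (fun z => (w z ^ 2)⁻¹) z :=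
  (Finset.add_sum_erase _ _ ((mem_box hζ 0).2 (by simpa using hζ))).symm

variable {ν : Measure (Space D)} [IsProbabilityMeasure ν]
  {ψ : HilbertBasis (Freq D) ℂ (Lp ℂ 2 ν)} {M : ℝ} {σ : Freq D → Freq D}

/-- The lower bound at cut-offs `ζ n` and signal strengths `1 / V n`. -/
theorem IsConjSystem.isOmega_minimaxRisk (H : IsConjSystem ψ M σ) (I : Set (Freq D))
    (hI : ∃ z ∈ I, z ≠ 0) (a b : Freq D → ℝ) (ha : ∀ z ∈ I, 0 < a z)
    (hb_zero : 0 ∈ I → 1 < b 0) (ζ V : ℕ → ℝ) (hζ : ∀ᶠ n in atTop, 1 ≤ ζ n)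
    (hV : ∀ᶠ n in atTop, 0 < V n) (hbV : ∀ᶠ n in atTop, weightSum I b (ζ n) ≤ V n) {C₁ C₂ : ℝ}
    (h₁ : ∀ᶠ n in atTop, ζ n ^ (2 * D) ≤ C₁ * V n)
    (h₂ : ∀ᶠ n : ℕ in atTop, ζ n ^ D * (n : ℝ) ^ 2 ≤ C₂ * V n ^ 2) :
    IsOmega (minimaxRisk ψ I a b)
      (fun n => max (weightSum I a (ζ n) ^ 2 / V n ^ 2) (1 / (n : ℝ))) := by
  set α := I.indicator (fun z => (a z ^ 2)⁻¹) 0 with hα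
  set β := I.indicator (fun z => (b z ^ 2)⁻¹) 0 with hβ
  have hβ1 : β < 1 := by
    by_cases h0 : (0 : Freq D) ∈ I
    · rw [hβ, Set.indicator_of_mem h0]
      exact inv_lt_one_of_one_lt₀ (one_lt_pow₀ (hb_zero h0) two_ne_zero)
    · rw [hβ, Set.indicator_of_notMem h0]
      exact one_pos
  have hM := H.nonneg
  have hσ : ∀ ζ : ℝ, 0 ≤ ζ → ∀ z ∈ (box D ζ).erase 0, σ z ∈ (box D ζ).erase 0 := by
    intro ζ h z hz
    rw [Finset.mem_erase, mem_box h] at hz ⊢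
    rw [← norm_ne_zero_iff, H.norm_conj, norm_ne_zero_iff]
    exact hz
  obtain ⟨c₂, hc₂, hinv⟩ : ∃ c : ℝ, 0 < c ∧ ∀ n : ℕ, 0 < n →
      ENNReal.ofReal (c / n) ≤ minimaxRisk ψ I a b n := by
    obtain ⟨z, hzI, hz⟩ := hI
    refine H.exists_minimaxRisk_ge_inv (Finset.notMem_erase _ _) (hσ ‖z‖ (norm_nonneg z)) I a b ?_
      hβ1
    refine Finset.sum_pos' (fun z _ => indicator_inv_sq_nonneg I a z) ⟨z, ?_, ?_⟩
    · exact Finset.mem_erase.2 ⟨hz, (mem_box (norm_nonneg z) z).2 le_rfl⟩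
    · rw [Set.indicator_of_mem hzI]
      have := ha z hzI
      positivity
  -- `β + k ≤ 1` keeps the perturbations in the ball. The second bound is the positivity condition
  -- squared, with `9 ^ D` coming from `|K|² ≤ (3 ζ)^(2D)`.
  obtain ⟨k, hk, hk1, hk2⟩ : ∃ k : ℝ, 0 < k ∧ β + k ≤ 1
      ∧ 9 ^ D * C₁ * k * (4 * M ^ 2) ≤ 1 / 4 := by
    have e1 : ∀ᶠ k : ℝ in 𝓝 0, β + k < 1 :=
      ContinuousAt.eventually_lt (by fun_prop) (by fun_prop) (by simpa using hβ1)
    have e2 : ∀ᶠ k : ℝ in 𝓝 0, 9 ^ D * C₁ * k * (4 * M ^ 2) < 1 / 4 :=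
      ContinuousAt.eventually_lt (by fun_prop) (by fun_prop) (by norm_num)
    have e3 : ∀ᶠ k : ℝ in 𝓝[>] 0, 0 < k := self_mem_nhdsWithin
    obtain ⟨k, h3, h1, h2⟩ := (e3.and ((e1.and e2).filter_mono nhdsWithin_le_nhds)).exists
    exact ⟨k, h3, h1.le, h2.le⟩
  set G := 3 ^ D * C₂ * k ^ 2 / 2 with hG
  set c₁ := k ^ 2 / (2 * (1 + Real.exp G)) with hc₁
  have hc₁0 : 0 < c₁ := by positivity
  -- The perturbations leave frequency `0` untouched, so its share `α` of `A_ζ` must be recovered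
  -- separately: `α² / V²` is `O(1 / n)` and is charged to the parametric bound.
  set q := 2 * α ^ 2 * |C₂| + 1 with hq
  have hq0 : 0 < q := by positivity
  refine ⟨min (c₁ / 4) (c₂ / (2 * q)), by positivity, ?_⟩
  filter_upwards [hζ, hV, hbV, h₁, h₂, eventually_gt_atTop 0] with n z1 v0 bV e1 e2 n0
  have n1 : (1 : ℝ) ≤ n := by exact_mod_cast n0
  have z0 : 0 ≤ ζ n := by linarith
  rw [weightSum_eq I a z0]
  rw [weightSum_eq I b z0] at bV
  set K := (box D (ζ n)).erase 0 with hK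
  set A := ∑ z ∈ K, I.indicator (fun z => (a z ^ 2)⁻¹) z with hA
  set B := ∑ z ∈ K, I.indicator (fun z => (b z ^ 2)⁻¹) z with hB
  rw [← hα]
  have hβ0 : 0 ≤ β := indicator_inv_sq_nonneg I b 0
  have hcard : (K.card : ℝ) ≤ (3 * ζ n) ^ D :=
    le_trans (by exact_mod_cast Finset.card_erase_le) (card_box_le z1)
  have ht2 : √(k / V n) ^ 2 = k / V n := Real.sq_sqrt (by positivity)
  have key := H.minimaxRisk_ge_of_signs (K := K) (Finset.notMem_erase _ _) (hσ _ z0) I a b n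
    (t := √(k / V n)) (G := G) (Real.sqrt_nonneg _) ?_ ?_ ?_
  · rw [ht2] at key
    have x1 : (k / V n * A) ^ 2 / (2 * (1 + Real.exp G)) = c₁ * (A ^ 2 / V n ^ 2) := by
      rw [hc₁]; field_simp
    rw [← hA, x1] at key
    have hmax : (c₁ * (A ^ 2 / V n ^ 2) + c₂ / n) / 2
        ≤ max (c₁ * (A ^ 2 / V n ^ 2)) (c₂ / n) := by
      linarith [le_max_left (c₁ * (A ^ 2 / V n ^ 2)) (c₂ / n),
        le_max_right (c₁ * (A ^ 2 / V n ^ 2)) (c₂ / n)]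
    have hfin : min (c₁ / 4) (c₂ / (2 * q)) * max ((α + A) ^ 2 / V n ^ 2) (1 / n)
        ≤ (c₁ * (A ^ 2 / V n ^ 2) + c₂ / n) / 2 := by
      have y1 : 1 / V n ^ 2 ≤ |C₂| / n := by
        rw [div_le_div_iff₀ (by positivity) (by positivity), one_mul]
        have : (1 : ℝ) ≤ ζ n ^ D := one_le_pow₀ z1
        calc (n : ℝ) ≤ 1 * (n : ℝ) ^ 2 := by nlinarith
          _ ≤ ζ n ^ D * (n : ℝ) ^ 2 := by gcongr
          _ ≤ C₂ * V n ^ 2 := e2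
          _ ≤ |C₂| * V n ^ 2 := by gcongr; exact le_abs_self _
      have y2 : max ((α + A) ^ 2 / V n ^ 2) (1 / n) ≤ 2 * (A ^ 2 / V n ^ 2) + q / n := by
        have y3 : (α + A) ^ 2 / V n ^ 2 ≤ 2 * (A ^ 2 / V n ^ 2) + 2 * α ^ 2 * |C₂| / n := by
          calc (α + A) ^ 2 / V n ^ 2 ≤ (2 * A ^ 2 + 2 * α ^ 2) / V n ^ 2 := by
                gcongr; nlinarith [sq_nonneg (α - A)]
            _ = 2 * (A ^ 2 / V n ^ 2) + 2 * α ^ 2 * (1 / V n ^ 2) := by ring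
            _ ≤ 2 * (A ^ 2 / V n ^ 2) + 2 * α ^ 2 * (|C₂| / n) := by gcongr
            _ = _ := by ring
        have y4 : q / n = 2 * α ^ 2 * |C₂| / n + 1 / n := by rw [hq, add_div]
        have y5 : 0 ≤ 2 * α ^ 2 * |C₂| / n := by positivity
        have y6 : 0 ≤ A ^ 2 / V n ^ 2 := by positivity
        have y7 : (0 : ℝ) ≤ 1 / n := by positivity
        exact max_le (by linarith) (by linarith)
      calc _ ≤ min (c₁ / 4) (c₂ / (2 * q)) * (2 * (A ^ 2 / V n ^ 2) + q / n) := by gcongr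
        _ = min (c₁ / 4) (c₂ / (2 * q)) * (2 * (A ^ 2 / V n ^ 2))
            + min (c₁ / 4) (c₂ / (2 * q)) * (q / n) := mul_add _ _ _
        _ ≤ c₁ / 4 * (2 * (A ^ 2 / V n ^ 2)) + c₂ / (2 * q) * (q / n) := by
            gcongr
            · exact min_le_left _ _
            · exact min_le_right _ _
        _ = _ := by field_simp; ring
    refine (ENNReal.ofReal_le_ofReal (hfin.trans hmax)).trans ?_
    rcases max_choice (c₁ * (A ^ 2 / V n ^ 2)) (c₂ / n) with h | h <;> rw [h]
    · exact key
    · exact hinv n n0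
  · refine abs_le_of_sq_le_sq' ?_ (by norm_num) |>.2
    calc (K.card * (√(k / V n) * (2 * M))) ^ 2 = (K.card : ℝ) ^ 2 * (k / V n) * (4 * M ^ 2) := by
          rw [mul_pow, mul_pow, ht2]; ring
      _ ≤ ((3 * ζ n) ^ D) ^ 2 * (k / V n) * (4 * M ^ 2) := by gcongr
      _ = 9 ^ D * ζ n ^ (2 * D) * (k / V n) * (4 * M ^ 2) := by
          rw [mul_pow, mul_pow, ← pow_mul, ← pow_mul, mul_comm D 2, pow_mul 3]; norm_num
      _ ≤ 9 ^ D * (C₁ * V n) * (k / V n) * (4 * M ^ 2) := by gcongr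
      _ = 9 ^ D * C₁ * k * (4 * M ^ 2) := by field_simp
      _ ≤ (1 / 2) ^ 2 := by linarith
  · rw [ht2]
    have : k / V n * B ≤ k := by
      rw [div_mul_eq_mul_div, div_le_iff₀ v0]
      exact mul_le_mul_of_nonneg_left (by linarith) hk.le
    linarith
  · rw [ht2]
    calc (K.card : ℝ) * ((n * (k / V n)) ^ 2 / 2)
        ≤ (3 * ζ n) ^ D * ((n * (k / V n)) ^ 2 / 2) := by gcongr
      _ = 3 ^ D * (ζ n ^ D * (n : ℝ) ^ 2) * (k / V n) ^ 2 / 2 := by rw [mul_pow]; ring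
      _ ≤ 3 ^ D * (C₂ * V n ^ 2) * (k / V n) ^ 2 / 2 := by gcongr
      _ = G := by rw [hG]; field_simp

end Rates

end QuadraticFourier

end

/-! ### The two regimes. -/

theorem mainTheorem2 {D : ℕ} (hD : 0 < D)
    (X : Set (QuadraticFourier.Space D)) (hX : IsCompact X)
    (μ : Measure (QuadraticFourier.Space D)) (hμ : μ X = 1)
    (ψ : HilbertBasis (QuadraticFourier.Freq D) ℂ (Lp ℂ 2 (μ.restrict X)))
    (hψ_const : ∀ᵐ x ∂(μ.restrict X), ψ 0 x = 1)
    (hψ_bdd : ∃ M : ℝ, ∀ z, ∀ᵐ x ∂(μ.restrict X), ‖ψ z x‖ ≤ M)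
    (hψ_conj : ∀ z, ∃ z', ‖z'‖ = ‖z‖ ∧
      ∀ᵐ x ∂(μ.restrict X), ψ z' x = (starRingEnd ℂ) (ψ z x))
    (I : Set (QuadraticFourier.Freq D)) (hI : ∃ z ∈ I, z ≠ 0)
    (a b : QuadraticFourier.Freq D → ℝ)
    (ha : ∀ z ∈ I, 0 < a z) (hb : ∀ z ∈ I, 0 < b z) (hb_zero : 0 ∈ I → 1 < b 0) :
    (∀ ζ : ℕ → ℝ, (∀ᶠ n in atTop, 1 ≤ ζ n) →
      (fun n => QuadraticFourier.weightSum I b (ζ n) ^ 2)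
        =Θ[atTop] (fun n => ζ n ^ D * (n : ℝ) ^ 2) →
      (fun n => ζ n ^ (2 * D)) =O[atTop] (fun n => QuadraticFourier.weightSum I b (ζ n)) →
      QuadraticFourier.IsOmega (QuadraticFourier.minimaxRisk ψ I a b)
        (fun n => max (QuadraticFourier.weightSum I a (ζ n) ^ 2
          / QuadraticFourier.weightSum I b (ζ n) ^ 2) (1 / (n : ℝ)))) ∧
    ((fun ζ : ℝ => QuadraticFourier.weightSum I b ζ) =o[atTop] (fun ζ : ℝ => ζ ^ (2 * D)) →
      QuadraticFourier.IsOmega (QuadraticFourier.minimaxRisk ψ I a b)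
        (fun n => max (QuadraticFourier.weightSum I a ((n : ℝ) ^ (2 / (3 * (D : ℝ)))) ^ 2
          / (n : ℝ) ^ (8 / 3 : ℝ)) (1 / (n : ℝ)))) := by
  have : IsProbabilityMeasure (μ.restrict X) := ⟨by rw [Measure.restrict_apply_univ, hμ]⟩
  obtain ⟨M, hM⟩ := hψ_bdd
  choose σ hσ hconj using hψ_conj
  have H : QuadraticFourier.IsConjSystem ψ (max M 0) σ :=
    ⟨le_max_right _ _, hψ_const, fun z => (hM z).mono fun x hx => hx.trans (le_max_left _ _), hσ,
      hconj⟩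
  have hB : ∀ ζ, 0 ≤ QuadraticFourier.weightSum I b ζ := fun ζ =>
    Finset.sum_nonneg fun z _ => QuadraticFourier.indicator_inv_sq_nonneg I b z
  constructor
  · intro ζ hζ hΘ hO
    obtain ⟨C₁, hC₁⟩ := hO.bound
    obtain ⟨C₂, hC₂⟩ := hΘ.2.bound
    have h₁ : ∀ᶠ n in atTop, ζ n ^ (2 * D) ≤ C₁ * QuadraticFourier.weightSum I b (ζ n) := by
      filter_upwards [hC₁] with n hn
      rw [Real.norm_of_nonneg (hB _)] at hn
      exact (le_abs_self _).trans hn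
    refine H.isOmega_minimaxRisk I hI a b ha hb_zero ζ _ hζ ?_ (Eventually.of_forall fun n => le_rfl)
      h₁ (C₂ := C₂) ?_
    · filter_upwards [h₁, hζ] with n hn h1
      refine lt_of_le_of_ne (hB _) fun h => ?_
      rw [← h, mul_zero] at hn
      linarith [one_le_pow₀ h1 (n := 2 * D)]
    · filter_upwards [hC₂] with n hn
      rw [Real.norm_of_nonneg (sq_nonneg (QuadraticFourier.weightSum I b (ζ n)))] at hn
      exact (le_abs_self _).trans hn
  · intro ho
    have hD' : (0 : ℝ) < D := by exact_mod_cast hD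
    have hpow : ∀ (n : ℕ) (m : ℕ) (r : ℝ), 2 / (3 * (D : ℝ)) * m = r →
        ((n : ℝ) ^ (2 / (3 * (D : ℝ)))) ^ m = (n : ℝ) ^ r := fun n m r h => by
      rw [← Real.rpow_mul_natCast (Nat.cast_nonneg n), h]
    have e1 : ∀ n : ℕ, ((n : ℝ) ^ (2 / (3 * (D : ℝ)))) ^ (2 * D) = (n : ℝ) ^ (4 / 3 : ℝ) :=
      fun n => hpow n _ _ (by push_cast; field_simp; norm_num)
    have e2 : ∀ n : ℕ, ((n : ℝ) ^ (2 / (3 * (D : ℝ)))) ^ D = (n : ℝ) ^ (2 / 3 : ℝ) :=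
      fun n => hpow n _ _ (by field_simp)
    have e3 : ∀ n : ℕ, ((n : ℝ) ^ (4 / 3 : ℝ)) ^ 2 = (n : ℝ) ^ (8 / 3 : ℝ) := fun n => by
      rw [← Real.rpow_mul_natCast (Nat.cast_nonneg n)]; norm_num
    simp_rw [← e3]
    -- With `ζ = n^(2/(3D))` and `V = n^(4/3)`, both `ζ^(2D) = V` and `ζ^D n² = V²` hold exactly for
    -- `n > 0`, while `B_ζ ≤ V` eventually by the little-o hypothesis.
    refine H.isOmega_minimaxRisk I hI a b ha hb_zero _ _ ?_ ?_ ?_ (C₁ := 1) (C₂ := 1) ?_ ?_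
    · filter_upwards [eventually_ge_atTop 1] with n hn
      exact Real.one_le_rpow (by exact_mod_cast hn) (by positivity)
    · filter_upwards [eventually_gt_atTop 0] with n hn
      have : (0 : ℝ) < n := by exact_mod_cast hn
      positivity
    · have ht : Tendsto (fun n : ℕ => (n : ℝ) ^ (2 / (3 * (D : ℝ)))) atTop atTop :=
        (tendsto_rpow_atTop (by positivity)).comp tendsto_natCast_atTop_atTop
      filter_upwards [ht.eventually (ho.bound one_pos)] with n hn
      rw [Real.norm_of_nonneg (hB _), e1, one_mul, Real.norm_of_nonneg (by positivity)] at hn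
      exact hn
    · exact Eventually.of_forall fun n => by rw [e1, one_mul]
    · filter_upwards [eventually_gt_atTop 0] with n hn
      have : (0 : ℝ) < n := by exact_mod_cast hn
      rw [e2, e3, one_mul, ← Real.rpow_natCast, ← Real.rpow_add this]
      norm_num
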